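/- **Setting.** For each sample size $n\in\mathbb N$ let $p=p_n\in\mathbb N$, $X=X_n\in\mathbb R^{n\times p}$, $\beta=\beta_n\in\mathbb R^p$, and observe $Y=X\beta+\epsilon$ with $\epsilon=\epsilon_n\sim\mathcal N(0,\sigma^2 I_n)$, where $\sigma>0$ does not depend on $n$. Let $\mathcal B^\Lambda=\{\hat\beta^\lambda\mid\lambda\in\Lambda\}$ be a family of first-step estimators indexed by a finite set $\Lambda=\Lambda_n\subset(0,\infty)$ of tuning parameters, and let $r=r_n:=|\Lambda_n|$. (The map $\hat\beta^1$ is also given, whether or not $1\in\Lambda$; all of these are functions of $X$ and $Y$.) Order the active sets $\operatorname{supp}\hat\beta^\lambda(Y)$, $\lambda\in\Lambda$, by increasing cardinality as $\hat S^1,\dots,\hat S^r$ (ties broken by an arbitrary rule), put $\hat S^{i,j}:=\hat S^i\cup\hat S^j$, and let $$\bar\beta^{i,j}\in\operatorname*{arg\,min}_{\operatorname{supp}(\xi)\subset\hat S^{i,j}}\|Y-X\xi\|_2^2 .$$ For $I\subset\{1,\dots,p\}$ let $P_I$ be the orthogonal projection of $\mathbb R^n$ onto the span of the columns $X_j$,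 $j\in I$. Define $$D(X\beta):=\inf\Big\{\|y-X\beta\|_\infty \;\Big|\; y\in\mathbb R^n,\ \exists\lambda\in\Lambda\ \forall\lambda'\in\Lambda:\ \operatorname{supp}\hat\beta^\lambda(y)\neq\operatorname{supp}\hat\beta^{\lambda'}(X\beta)\Big\},\qquad \inf\emptyset=+\infty .$$ **Theorem.** Suppose that for every $n$ the family is scale-symmetric, i.e. $\operatorname{supp}\hat\beta^\lambda(Y)=\operatorname{supp}\hat\beta^1(Y/\lambda)$ for all $\lambda\in\Lambda$, $Y\in\mathbb R^n$ and $X\in\mathbb R^{n\times p}$, and that there are a constant $\tilde c>\sqrt6\,\sigma$ and an integer $n_1$ with $D(X\beta)\ge\tilde c\sqrt{\log n}$ for all $n\ge n_1$. Then for any $t>6$ there is a deterministic integer $n_0$ such that, for every $n\ge n_0$ with $r\ge 2$, with probability at least $1-\frac1t-\frac{2t\log r}{r}$ the bound $$\|X\bar\beta^{i,j}-X\beta\|_2^2\le\sigma^2(1+t\log r)\,|\hat S^{i,j}|+\|(I-P_{\hat S^{i,j}})X\beta\|_2^2$$ holds simultaneously for all $i,j\in\{1,\dots,r\}$. In particular,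 for these $n$ the following holds with the positive constants $b=\frac1t+\frac{2t\log r}{r}$ and $c=\sigma^2(1+t\log r)$: with probability at least $1-b$, for all $i,j\in\{1,\dots,r\}$ simultaneously, $\|X\bar\beta^{i,j}-X\beta\|_2^2\le c\,|\hat S^{i,j}|+\|(I-P_{\hat S^{i,j}})X\beta\|_2^2$. -/

import Mathlib

open MeasureTheory ProbabilityTheory
open scoped ENNReal NNReal Matrix

noncomputable section

namespace AVPrediction

/-- A family of first-step estimators `(lam, X, Y) ↦ βhat^lam(X, Y)` for sample size `n` and `p`
parameters. The tuning parameter set `Λ` is specified separately; the values outside `Λ ∪ {1}` are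
never used. -/
abbrev FirstStepFamily (n p : ℕ) : Type :=
  ℝ → Matrix (Fin n) (Fin p) ℝ → (Fin n → ℝ) → (Fin p → ℝ)

/-- The support `{j | b j ≠ 0}` of a coefficient vector. -/
def coordSupport {p : ℕ} (b : Fin p → ℝ) : Finset (Fin p) := {j | b j ≠ 0}

/-- The squared Euclidean norm `‖v‖₂²`. -/
def sqNorm {n : ℕ} (v : Fin n → ℝ) : ℝ := ‖WithLp.toLp 2 v‖ ^ 2

/-- Scale symmetry: `supp βhat^lam(Y) = supp βhat^1(Y / lam)` for all `lam ∈ Λ`, `X` and `Y`. -/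
def ScaleSymmetric {n p : ℕ} (B : FirstStepFamily n p) (Λ : Finset ℝ) : Prop :=
  ∀ lam ∈ Λ, ∀ (X : Matrix (Fin n) (Fin p) ℝ) (Y : Fin n → ℝ),
    coordSupport (B lam X Y) = coordSupport (B 1 X (lam⁻¹ • Y))

/-- `pathRobustness B Λ X ξ` is `D(ξ)`: the infimum of `‖y - ξ‖_∞` over all `y` for which some
active set on the path at `y` does not occur on the path at `ξ` (and `∞` if there is no such `y`).
The extended distance on `Fin n → ℝ` is that of the maximum norm. -/
def pathRobustness {n p : ℕ} (B : FirstStepFamily n p) (Λ : Finset ℝ)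
    (X : Matrix (Fin n) (Fin p) ℝ) (ξ : Fin n → ℝ) : ℝ≥0∞ :=
  ⨅ y ∈ {y : Fin n → ℝ | ∃ lam ∈ Λ, ∀ lam' ∈ Λ,
    coordSupport (B lam X y) ≠ coordSupport (B lam' X ξ)}, edist y ξ

/-- The path `S 1, …, S r` of active sets at the data `Y`, one set for each of the `r = |Λ|` tuning
parameters, listed by increasing cardinality (ties in any order). -/
def IsOrderedPath {n p : ℕ} (B : FirstStepFamily n p) (Λ : Finset ℝ)
    (X : Matrix (Fin n) (Fin p) ℝ) (Y : Fin n → ℝ) (S : Fin Λ.card → Finset (Fin p)) : Prop :=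
  (∃ e : Fin Λ.card ≃ Λ, ∀ i, S i = coordSupport (B (e i) X Y)) ∧
    Monotone fun i => (S i).card

/-- An ordered path always exists. -/
theorem exists_isOrderedPath {n p : ℕ} (B : FirstStepFamily n p) (Λ : Finset ℝ)
    (X : Matrix (Fin n) (Fin p) ℝ) (Y : Fin n → ℝ) :
    ∃ S, IsOrderedPath B Λ X Y S := by
  let f : Fin Λ.card → ℕ := fun i => (coordSupport (B (Λ.equivFin.symm i) X Y)).card
  refine ⟨fun i => coordSupport (B (Λ.equivFin.symm (Tuple.sort f i)) X Y),
    ⟨(Tuple.sort f).trans Λ.equivFin.symm, fun i => rfl⟩, ?_⟩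
  exact Tuple.monotone_sort f

/-- `b` is a least-squares estimator on the active set `S`, i.e. a minimizer of `‖Y - X ξ‖₂²` over
all `ξ` with `supp ξ ⊆ S`. -/
def IsLeastSquares {n p : ℕ} (X : Matrix (Fin n) (Fin p) ℝ) (Y : Fin n → ℝ)
    (S : Finset (Fin p)) (b : Fin p → ℝ) : Prop :=
  coordSupport b ⊆ S ∧
    ∀ ξ : Fin p → ℝ, coordSupport ξ ⊆ S → sqNorm (Y - X *ᵥ b) ≤ sqNorm (Y - X *ᵥ ξ)

/-- `P_S v`, the orthogonal projection (for the Euclidean inner product) of `v` onto the span of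
the columns `X_j`, `j ∈ S`. -/
def proj {n p : ℕ} (X : Matrix (Fin n) (Fin p) ℝ) (S : Finset (Fin p)) (v : Fin n → ℝ) :
    Fin n → ℝ :=
  WithLp.ofLp ((Submodule.span ℝ ((fun j => WithLp.toLp 2 (X.col j)) '' (S : Set (Fin p)))
    : Submodule ℝ (EuclideanSpace ℝ (Fin n))).starProjection (WithLp.toLp 2 v))

/-- The growth condition: for some constant `c` exceeding `√6 σ` one has
`D(X β) ≥ c √(log n)` for all sufficiently large `n`. -/
def GrowthCondition (σ : ℝ≥0) {p : ℕ → ℕ} (B : ∀ n, FirstStepFamily n (p n)) (Λ : ℕ → Finset ℝ)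
    (X : ∀ n, Matrix (Fin n) (Fin (p n)) ℝ) (β : ∀ n, Fin (p n) → ℝ) : Prop :=
  ∃ c : ℝ, √6 * σ < c ∧ ∃ n₁ : ℕ, ∀ n ≥ n₁,
    ENNReal.ofReal (c * √(Real.log n)) ≤ pathRobustness (B n) (Λ n) (X n) (X n *ᵥ β n)

/-- The prediction bounds with constants `b` and `c`: with probability at least `1 - b`,
`‖X βbar^{i,j} - X β‖² ≤ c |S^{i,j}| + ‖(1 - P_{S^{i,j}}) X β‖²` for all `i, j` simultaneously,
where `S^{i,j} = S^i ∪ S^j`. The sets and estimators are random. -/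
def PredictionBounds {Ω : Type*} [MeasurableSpace Ω] (μ : Measure Ω) {n p r : ℕ}
    (X : Matrix (Fin n) (Fin p) ℝ) (β : Fin p → ℝ)
    (S : Ω → Fin r → Finset (Fin p)) (βbar : Ω → Fin r → Fin r → (Fin p → ℝ))
    (b c : ℝ) : Prop :=
  0 < b ∧ 0 < c ∧
    1 - b ≤ μ.real {ω | ∀ i j : Fin r,
      sqNorm (X *ᵥ βbar ω i j - X *ᵥ β) ≤
        c * ((S ω i ∪ S ω j).card : ℝ) +
          sqNorm (X *ᵥ β - proj X (S ω i ∪ S ω j) (X *ᵥ β))}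

end AVPrediction

end

/-!
Write `a = 1 + t log r` and fix a sample size. The refitted values `X βbar^{i,j}` are the orthogonal
projection of the data on the span of the columns in `S^{i,j}`
(`IsLeastSquares.mulVec_eq_proj`), so by Pythagoras (`sqNorm_proj_add_sub`) the prediction error is
`‖P ε‖² + ‖(1 - P) X β‖²`, and only `‖P ε‖² ≤ σ² a |S^{i,j}|` has to be shown.

For a deterministic set `T`, the variable `‖P_T ε‖² / σ²` is chi-square with at most `|T|` degrees of
freedom, because the marginal of a standard Gaussian vector on a subspace is standard Gaussian.
Chernoff's bound with the optimal exponent bounds the probability that it exceeds `a |T|` by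
`√a exp (-(a - 1) / 2) = √a r ^ (-t / 2)` (`stdGaussian_real_le_sq_norm`).

The sets `S^{i,j}` are random, but the robustness assumption makes them range over few values: if
`‖ε‖_∞ < D(X β)`, every active set at the data already occurs on the path at `X β`
(`IsOrderedPath.exists_eq_of_edist_lt`), so `S^{i,j}` is one of `r²` deterministic unions. A union
bound costs at most `r² √a r ^ (-t / 2) ≤ 2 t log r / r`, since `t > 6`. The exceptional event
`‖ε‖_∞ ≥ c √(log n)` has probability at most `2 n exp (-c² log n / (2 σ²)) ≤ 2 / n²`, since
`c² ≥ 6 σ²`, and this is at most `1 / t` once `n ≥ 2 t`.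
-/

namespace AVPrediction

/-! ### Exponential moments and tails of Gaussian vectors -/

lemma gaussianPDFReal_zero_one_mul_exp (s x : ℝ) :
    gaussianPDFReal 0 1 x * Real.exp (s * x ^ 2) =
      (√(2 * Real.pi))⁻¹ * Real.exp (-(1 / 2 - s) * x ^ 2) := by
  simp only [gaussianPDFReal_def, NNReal.coe_one, mul_one, sub_zero, mul_assoc, ← Real.exp_add]
  congr 2
  ring

lemma integrable_exp_mul_sq_gaussianReal {s : ℝ} (hs : s < 1 / 2) :
    Integrable (fun x => Real.exp (s * x ^ 2)) (gaussianReal 0 1) := by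
  rw [gaussianReal_of_var_ne_zero _ one_ne_zero, integrable_withDensity_iff_integrable_smul₀'
    (measurable_gaussianPDF 0 1).aemeasurable (ae_of_all _ fun _ => gaussianPDF_lt_top)]
  simp only [toReal_gaussianPDF, smul_eq_mul, gaussianPDFReal_zero_one_mul_exp]
  exact (integrable_exp_neg_mul_sq (by linarith)).const_mul _

/-- The moment generating function of a chi-square variable with one degree of freedom. -/
lemma integral_exp_mul_sq_gaussianReal {s : ℝ} (hs : s < 1 / 2) :
    ∫ x, Real.exp (s * x ^ 2) ∂gaussianReal 0 1 = (√(1 - 2 * s))⁻¹ := by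
  rw [integral_gaussianReal_eq_integral_smul one_ne_zero]
  simp only [smul_eq_mul, gaussianPDFReal_zero_one_mul_exp]
  rw [integral_const_mul, integral_gaussian, ← Real.sqrt_inv, ← Real.sqrt_inv,
    ← Real.sqrt_mul (by positivity)]
  congr 1
  have : (1 : ℝ) / 2 - s ≠ 0 := by linarith
  have : (1 : ℝ) - 2 * s ≠ 0 := by linarith
  have := Real.pi_ne_zero
  field_simp

section StdGaussian

variable {E : Type*} [NormedAddCommGroup E] [InnerProductSpace ℝ E] [FiniteDimensional ℝ E]
  [MeasurableSpace E] [BorelSpace E]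

/-- In coordinates, `‖x‖²` is a sum of squares of independent standard Gaussians. -/
lemma integrable_and_mgf_sq_norm_stdGaussian {s : ℝ} (hs : s < 1 / 2) :
    Integrable (fun x : E => Real.exp (s * ‖x‖ ^ 2)) (stdGaussian E) ∧
      mgf (fun x : E => ‖x‖ ^ 2) (stdGaussian E) s =
        (√(1 - 2 * s))⁻¹ ^ Module.finrank ℝ E := by
  let b := stdOrthonormalBasis ℝ E
  have hb : Measurable fun x : Fin (Module.finrank ℝ E) → ℝ => ∑ i, x i • b i := by fun_prop
  have hexp : Continuous fun x : E => Real.exp (s * ‖x‖ ^ 2) := by fun_prop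
  have hprod (x : Fin (Module.finrank ℝ E) → ℝ) :
      Real.exp (s * ‖∑ i, x i • b i‖ ^ 2) = ∏ i, Real.exp (s * x i ^ 2) := by
    rw [← b.sum_sq_inner_right, Finset.mul_sum, Real.exp_sum]
    simp [b.orthonormal.inner_right_fintype]
  rw [stdGaussian_eq_map_pi_orthonormalBasis b]
  refine ⟨?_, ?_⟩
  · rw [integrable_map_measure hexp.aestronglyMeasurable hb.aemeasurable]
    simp only [Function.comp_def, hprod]
    exact Integrable.fintype_prod (f := fun _ x => Real.exp (s * x ^ 2))
      fun _ => integrable_exp_mul_sq_gaussianReal hs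
  · rw [mgf, integral_map hb.aemeasurable hexp.aestronglyMeasurable]
    simp only [hprod]
    rw [integral_fintype_prod_eq_prod (f := fun _ x => Real.exp (s * x ^ 2))]
    simp [integral_exp_mul_sq_gaussianReal hs]

/-- A chi-square tail bound: the Chernoff bound with the optimal parameter `(1 - 1 / a) / 2`
yields `(√a * exp (-(a - 1) / 2)) ^ k`, whose base is at most `1`. -/
lemma stdGaussian_real_le_sq_norm {k : ℕ} (hk : 1 ≤ k) (hE : Module.finrank ℝ E ≤ k) {a : ℝ}
    (ha : 1 ≤ a) :
    (stdGaussian E).real {x | a * k ≤ ‖x‖ ^ 2} ≤ √a * Real.exp (-(a - 1) / 2) := by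
  have ha0 : 0 < a := by linarith
  set s : ℝ := (1 - 1 / a) / 2 with hs
  have hs0 : 0 ≤ s := by
    have : 1 / a ≤ 1 := by rw [div_le_one ha0]; exact ha
    linarith
  have hs1 : s < 1 / 2 := by
    have : 0 < 1 / a := by positivity
    linarith
  obtain ⟨hint, hmgf⟩ := integrable_and_mgf_sq_norm_stdGaussian (E := E) hs1
  have hroot : (√(1 - 2 * s))⁻¹ = √a := by
    rw [← Real.sqrt_inv]; congr 1; rw [hs]; field_simp; ring
  have hbase : √a * Real.exp (-(a - 1) / 2) ≤ 1 := by
    -- The square of this inequality is `a ≤ exp (a - 1)`.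
    have h : √a ≤ Real.exp ((a - 1) / 2) := by
      rw [Real.sqrt_le_left (Real.exp_pos _).le, ← Real.exp_nat_mul]
      have := Real.add_one_le_exp (a - 1)
      ring_nf at this ⊢
      exact this
    calc √a * Real.exp (-(a - 1) / 2) ≤ Real.exp ((a - 1) / 2) * Real.exp (-(a - 1) / 2) := by
          gcongr
      _ = 1 := by rw [← Real.exp_add]; simp; ring
  calc (stdGaussian E).real {x | a * k ≤ ‖x‖ ^ 2}
      ≤ Real.exp (-s * (a * k)) * √a ^ Module.finrank ℝ E := by
        simpa only [hmgf, hroot] using measure_ge_le_exp_mul_mgf (a * k : ℝ) hs0 hint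
    _ ≤ Real.exp (-s * (a * k)) * √a ^ k := by
        gcongr
        exact Real.one_le_sqrt.2 ha
    _ = (√a * Real.exp (-(a - 1) / 2)) ^ k := by
        rw [mul_pow, ← Real.exp_nat_mul, mul_comm]
        congr 2
        rw [hs]; field_simp
    _ ≤ √a * Real.exp (-(a - 1) / 2) := pow_le_of_le_one (by positivity) hbase (by omega)

/-- The projection is adjoint to the inclusion `K → E`, which preserves the characteristic function
`u ↦ exp (-‖u‖² / 2)`. -/
lemma stdGaussian_map_orthogonalProjectionOnto (K : Submodule ℝ E) :
    (stdGaussian E).map K.orthogonalProjectionOnto = stdGaussian K := by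
  have hmeas : Measurable K.orthogonalProjectionOnto :=
    K.orthogonalProjectionOnto.continuous.measurable
  have : IsProbabilityMeasure ((stdGaussian E).map K.orthogonalProjectionOnto) :=
    Measure.isProbabilityMeasure_map hmeas.aemeasurable
  apply Measure.ext_of_charFun
  ext u
  rw [charFun_apply, integral_map hmeas.aemeasurable (by fun_prop), charFun_stdGaussian]
  simp only [Submodule.inner_orthogonalProjectionOnto_eq_of_mem_right]
  rw [← charFun_apply, charFun_stdGaussian, Submodule.coe_norm]

end StdGaussian

section IsotropicGaussian

variable {n : ℕ} {σ : ℝ≥0}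

/-- An isotropic Gaussian vector is a rescaled standard Gaussian vector. -/
lemma pi_gaussianReal_eq_map_stdGaussian :
    (Measure.pi fun _ : Fin n => gaussianReal 0 (σ ^ 2)) =
      (stdGaussian (EuclideanSpace ℝ (Fin n))).map fun x => (σ : ℝ) • x.ofLp := by
  have h : gaussianReal 0 (σ ^ 2) = (gaussianReal 0 1).map fun x => (σ : ℝ) * x := by
    rw [gaussianReal_map_const_mul]
    congr 1
    · simp
    · ext; simp
  have : IsProbabilityMeasure ((gaussianReal 0 1).map fun x => (σ : ℝ) * x) := by
    rw [← h]; infer_instance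
  rw [← map_pi_eq_stdGaussian, Measure.map_map (by fun_prop) (by fun_prop), h,
    ← Measure.pi_map_pi (μ := fun _ : Fin n => gaussianReal 0 1)
      (f := fun _ x => (σ : ℝ) * x) (fun _ => by fun_prop)]
  rfl

/-- The projection of the noise on the span of the columns in `T` has a chi-square tail. The strict
inequality makes the event empty for `T = ∅`. -/
lemma pi_gaussianReal_real_lt_sqNorm_proj (hσ : 0 < σ) {p : ℕ}
    (X : Matrix (Fin n) (Fin p) ℝ) (T : Finset (Fin p)) {a : ℝ} (ha : 1 ≤ a) :
    (Measure.pi fun _ : Fin n => gaussianReal 0 (σ ^ 2)).real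
      {e | (σ : ℝ) ^ 2 * a * T.card < sqNorm (proj X T e)} ≤ √a * Real.exp (-(a - 1) / 2) := by
  set K : Submodule ℝ (EuclideanSpace ℝ (Fin n)) :=
    Submodule.span ℝ ((fun j => WithLp.toLp 2 (X.col j)) '' (T : Set (Fin p))) with hK
  have hσ' : (0 : ℝ) < σ := hσ
  have hsq (e : Fin n → ℝ) :
      sqNorm (proj X T e) = ‖K.orthogonalProjectionOnto (WithLp.toLp 2 e)‖ ^ 2 := rfl
  rcases T.eq_empty_or_nonempty with rfl | hT
  · have hK0 : K = ⊥ := by simp [hK]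
    have h0 (e : Fin n → ℝ) : sqNorm (proj X ∅ e) = 0 := by
      rw [hsq, sq_eq_zero_iff, norm_eq_zero]
      ext1
      simp [hK0]
    simp only [h0, Finset.card_empty, Nat.cast_zero, mul_zero, lt_irrefl, Set.ofPred_false,
      measureReal_empty]
    positivity
  · have hdim : Module.finrank ℝ K ≤ T.card := by
      classical
      rw [hK, ← Finset.coe_image]
      exact (finrank_span_finset_le_card _).trans Finset.card_image_le
    have hmeas : Measurable K.orthogonalProjectionOnto :=
      K.orthogonalProjectionOnto.continuous.measurable
    have hset : MeasurableSet {x : K | a * T.card ≤ ‖x‖ ^ 2} :=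
      measurableSet_le (by fun_prop) (by fun_prop)
    have hbad : MeasurableSet {e : Fin n → ℝ | (σ : ℝ) ^ 2 * a * T.card < sqNorm (proj X T e)} := by
      simp only [hsq]
      exact measurableSet_lt (by fun_prop) (by fun_prop)
    refine le_trans ?_ (stdGaussian_real_le_sq_norm (E := K) hT.card_pos hdim ha)
    rw [← stdGaussian_map_orthogonalProjectionOnto, pi_gaussianReal_eq_map_stdGaussian,
      map_measureReal_apply (by fun_prop) hbad, map_measureReal_apply hmeas hset]
    refine measureReal_mono fun x hx => ?_
    simp only [Set.mem_preimage, Set.mem_ofPred_eq, hsq] at hx ⊢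
    have hx' : WithLp.toLp 2 ((σ : ℝ) • x.ofLp) = (σ : ℝ) • x := rfl
    rw [hx', map_smul, norm_smul, mul_pow, Real.norm_eq_abs, sq_abs, mul_assoc] at hx
    exact (lt_of_mul_lt_mul_left hx (by positivity)).le

/-- The Chernoff bound for each coordinate, and the union bound. -/
lemma pi_gaussianReal_real_le_norm {c : ℝ} (hσ : 0 < σ) (hc : 0 < c) :
    (Measure.pi fun _ : Fin n => gaussianReal 0 (σ ^ 2)).real {e | c ≤ ‖e‖} ≤
      n * (2 * Real.exp (-c ^ 2 / (2 * (σ : ℝ) ^ 2))) := by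
  have hσ' : (0 : ℝ) < σ := hσ
  have hright : (gaussianReal 0 (σ ^ 2)).real {x | c ≤ x} ≤
      Real.exp (-c ^ 2 / (2 * (σ : ℝ) ^ 2)) := by
    refine (measure_ge_le_exp_mul_mgf (X := fun x => x) (t := c / (σ : ℝ) ^ 2) c (by positivity)
      (integrable_exp_mul_gaussianReal _)).trans_eq ?_
    rw [mgf_fun_id_gaussianReal, ← Real.exp_add]
    congr 1
    push_cast
    field_simp
    ring
  have hleft : (gaussianReal 0 (σ ^ 2)).real {x | c ≤ -x} ≤
      Real.exp (-c ^ 2 / (2 * (σ : ℝ) ^ 2)) := by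
    have hneg : (gaussianReal 0 (σ ^ 2)).map (fun x => -x) = gaussianReal 0 (σ ^ 2) := by
      simp [gaussianReal_map_neg]
    rw [← hneg, map_measureReal_apply measurable_neg
      (measurableSet_le (by fun_prop) (by fun_prop))] at hright
    exact hright
  have habs : (gaussianReal 0 (σ ^ 2)).real {x | c ≤ |x|} ≤
      2 * Real.exp (-c ^ 2 / (2 * (σ : ℝ) ^ 2)) := by
    have hset : {x : ℝ | c ≤ |x|} = {x | c ≤ x} ∪ {x | c ≤ -x} := by
      ext x; simp [le_abs]
    rw [hset, two_mul]
    exact (measureReal_union_le _ _).trans (add_le_add hright hleft)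
  have hcover : {e : Fin n → ℝ | c ≤ ‖e‖} ⊆ ⋃ i : Fin n, Function.eval i ⁻¹' {x | c ≤ |x|} := by
    intro e he
    by_contra h
    simp only [Set.mem_iUnion, Set.mem_preimage, Set.mem_ofPred_eq, not_exists, not_le,
      Function.eval] at h
    exact absurd he (not_le.2 ((pi_norm_lt_iff hc).2 h))
  calc _ ≤ (Measure.pi fun _ : Fin n => gaussianReal 0 (σ ^ 2)).real
        (⋃ i : Fin n, Function.eval i ⁻¹' {x | c ≤ |x|}) := measureReal_mono hcover
    _ ≤ ∑ i : Fin n, (Measure.pi fun _ : Fin n => gaussianReal 0 (σ ^ 2)).real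
        (Function.eval i ⁻¹' {x | c ≤ |x|}) := measureReal_iUnion_fintype_le _
    _ = ∑ _i : Fin n, (gaussianReal 0 (σ ^ 2)).real {x | c ≤ |x|} := by
        refine Finset.sum_congr rfl fun i _ => ?_
        rw [measureReal_def, (measurePreserving_eval _ i).measure_preimage
          (measurableSet_le (by fun_prop) (by fun_prop)).nullMeasurableSet, measureReal_def]
    _ ≤ _ := by
        rw [Finset.sum_const, Finset.card_univ, Fintype.card_fin, nsmul_eq_mul]
        gcongr

end IsotropicGaussian

/-! ### Least squares as orthogonal projection -/

lemma mem_span_col_iff {n p : ℕ} (X : Matrix (Fin n) (Fin p) ℝ) (T : Finset (Fin p))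
    (v : EuclideanSpace ℝ (Fin n)) :
    v ∈ Submodule.span ℝ ((fun j => WithLp.toLp 2 (X.col j)) '' (T : Set (Fin p))) ↔
      ∃ ξ : Fin p → ℝ, coordSupport ξ ⊆ T ∧ WithLp.toLp 2 (X *ᵥ ξ) = v := by
  classical
  have hmul (ξ : Fin p → ℝ) :
      WithLp.toLp 2 (X *ᵥ ξ) = ∑ j, ξ j • WithLp.toLp 2 (X.col j) := by
    ext i
    simp [Matrix.mulVec, dotProduct, mul_comm]
  constructor
  · rw [Submodule.mem_span_image_finset_iff_exists_fun]
    rintro ⟨c, rfl⟩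
    refine ⟨fun j => if h : j ∈ T then c ⟨j, h⟩ else 0, fun j hj => ?_, ?_⟩
    · by_contra h
      simp [coordSupport, h] at hj
    · rw [hmul, ← Finset.sum_subset (Finset.subset_univ T) (by intro j _ hj; simp [hj]),
        ← Finset.sum_coe_sort T]
      simp
  · rintro ⟨ξ, hξ, rfl⟩
    rw [hmul]
    refine Submodule.sum_mem _ fun j _ => ?_
    by_cases hj : ξ j = 0
    · simp [hj]
    · exact Submodule.smul_mem _ _ (Submodule.subset_span
        ⟨j, hξ (by simpa [coordSupport] using hj), rfl⟩)

/-- Fitted values of a least-squares estimator are the projection of the data. -/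
lemma IsLeastSquares.mulVec_eq_proj {n p : ℕ} {X : Matrix (Fin n) (Fin p) ℝ} {y : Fin n → ℝ}
    {T : Finset (Fin p)} {b : Fin p → ℝ} (hb : IsLeastSquares X y T b) :
    X *ᵥ b = proj X T y := by
  set K : Submodule ℝ (EuclideanSpace ℝ (Fin n)) :=
    Submodule.span ℝ ((fun j => WithLp.toLp 2 (X.col j)) '' (T : Set (Fin p))) with hK
  set u := WithLp.toLp 2 y
  set w := WithLp.toLp 2 (X *ᵥ b)
  have hw : w ∈ K := (mem_span_col_iff X T w).2 ⟨b, hb.1, rfl⟩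
  obtain ⟨ξ, hξ, hξu⟩ := (mem_span_col_iff X T _).1 (K.starProjection_apply_mem u)
  have hmin : ‖u - w‖ ^ 2 ≤ ‖u - K.starProjection u‖ ^ 2 := by
    rw [← hξu]
    exact hb.2 ξ hξ
  have horth : inner ℝ (u - K.starProjection u) (K.starProjection u - w) = 0 :=
    K.starProjection_inner_eq_zero u _ (K.sub_mem (K.starProjection_apply_mem u) hw)
  have hpyth := norm_add_sq_eq_norm_sq_add_norm_sq_real horth
  rw [sub_add_sub_cancel] at hpyth
  have h0 : ‖K.starProjection u - w‖ = 0 := by nlinarith [norm_nonneg (K.starProjection u - w)]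
  exact congrArg WithLp.ofLp (sub_eq_zero.1 (norm_eq_zero.1 h0)).symm

/-- The bias-variance decomposition, `ξ` being the mean and `e` the noise. -/
lemma sqNorm_proj_add_sub {n p : ℕ} (X : Matrix (Fin n) (Fin p) ℝ) (T : Finset (Fin p))
    (ξ e : Fin n → ℝ) :
    sqNorm (proj X T (ξ + e) - ξ) = sqNorm (proj X T e) + sqNorm (ξ - proj X T ξ) := by
  set K : Submodule ℝ (EuclideanSpace ℝ (Fin n)) :=
    Submodule.span ℝ ((fun j => WithLp.toLp 2 (X.col j)) '' (T : Set (Fin p))) with hK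
  have horth : inner ℝ (K.starProjection (WithLp.toLp 2 e))
      (-(WithLp.toLp 2 ξ - K.starProjection (WithLp.toLp 2 ξ))) = 0 := by
    rw [inner_neg_right, real_inner_comm, K.starProjection_inner_eq_zero _ _
      (K.starProjection_apply_mem _), neg_zero]
  have hpyth := norm_add_sq_eq_norm_sq_add_norm_sq_real horth
  rw [norm_neg, ← sq, ← sq, ← sq] at hpyth
  rw [show sqNorm (proj X T e) + sqNorm (ξ - proj X T ξ) = _ from hpyth.symm]
  simp only [sqNorm, proj, ← hK, WithLp.toLp_sub, WithLp.toLp_ofLp, WithLp.toLp_add, map_add]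
  congr 2
  abel

/-! ### Stability of the path -/

/-- Data within the robustness radius of `ξ` produce only active sets from the path at `ξ`. -/
lemma IsOrderedPath.exists_eq_of_edist_lt {n p : ℕ} {B : FirstStepFamily n p} {Λ : Finset ℝ}
    {X : Matrix (Fin n) (Fin p) ℝ} {y ξ : Fin n → ℝ} {S S' : Fin Λ.card → Finset (Fin p)}
    (hS : IsOrderedPath B Λ X y S) (hS' : IsOrderedPath B Λ X ξ S')
    (hy : edist y ξ < pathRobustness B Λ X ξ) (i : Fin Λ.card) : ∃ k, S i = S' k := by
  obtain ⟨⟨e, he⟩, -⟩ := hS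
  obtain ⟨⟨e', he'⟩, -⟩ := hS'
  by_contra! h
  refine absurd hy (not_lt.2 (iInf₂_le y ⟨e i, (e i).2, fun lam hlam heq => ?_⟩))
  exact h (e'.symm ⟨lam, hlam⟩) (by rw [he, he', heq]; simp)

/-! ### The prediction bound -/

/-- The finite-sample form of the bound. If the noise has maximum norm below the robustness radius,
every `S i ∪ S j` at the data is one of the `r ^ 2` deterministic sets formed from the path at
`X β`, so that a union bound over these sets controls the projected noise. -/
lemma le_measureReal_forall_prediction {Ω : Type*} [MeasurableSpace Ω] {μ : Measure Ω}
    [IsProbabilityMeasure μ] {σ : ℝ≥0} (hσ : 0 < σ) {n p : ℕ}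
    {X : Matrix (Fin n) (Fin p) ℝ} {β : Fin p → ℝ} {ε : Ω → Fin n → ℝ}
    (hε : HasLaw ε (Measure.pi fun _ : Fin n => gaussianReal 0 (σ ^ 2)) μ)
    {B : FirstStepFamily n p} {Λ : Finset ℝ} {c a : ℝ} (hc : 0 < c)
    (hD : ENNReal.ofReal c ≤ pathRobustness B Λ X (X *ᵥ β)) (ha : 1 ≤ a)
    {S : (Fin n → ℝ) → Fin Λ.card → Finset (Fin p)} (hS : ∀ y, IsOrderedPath B Λ X y (S y))
    {βbar : (Fin n → ℝ) → Fin Λ.card → Fin Λ.card → (Fin p → ℝ)}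
    (hβbar : ∀ y i j, IsLeastSquares X y (S y i ∪ S y j) (βbar y i j)) :
    1 - n * (2 * Real.exp (-c ^ 2 / (2 * (σ : ℝ) ^ 2))) -
        (Λ.card : ℝ) ^ 2 * (√a * Real.exp (-(a - 1) / 2)) ≤
      μ.real {ω | ∀ i j : Fin Λ.card,
        sqNorm (X *ᵥ βbar (X *ᵥ β + ε ω) i j - X *ᵥ β) ≤
          (σ : ℝ) ^ 2 * a * ((S (X *ᵥ β + ε ω) i ∪ S (X *ᵥ β + ε ω) j).card : ℝ) +
            sqNorm (X *ᵥ β - proj X (S (X *ᵥ β + ε ω) i ∪ S (X *ᵥ β + ε ω) j) (X *ᵥ β))} := by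
  set G := {ω | ∀ i j : Fin Λ.card,
    sqNorm (X *ᵥ βbar (X *ᵥ β + ε ω) i j - X *ᵥ β) ≤
      (σ : ℝ) ^ 2 * a * ((S (X *ᵥ β + ε ω) i ∪ S (X *ᵥ β + ε ω) j).card : ℝ) +
        sqNorm (X *ᵥ β - proj X (S (X *ᵥ β + ε ω) i ∪ S (X *ᵥ β + ε ω) j) (X *ᵥ β))} with hG
  set γ : Measure (Fin n → ℝ) := Measure.pi fun _ : Fin n => gaussianReal 0 (σ ^ 2) with hγ
  let S₀ := S (X *ᵥ β)
  let A : Set (Fin n → ℝ) := {e | c ≤ ‖e‖}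
  let U : Fin Λ.card × Fin Λ.card → Set (Fin n → ℝ) := fun q =>
    {e | (σ : ℝ) ^ 2 * a * (S₀ q.1 ∪ S₀ q.2).card < sqNorm (proj X (S₀ q.1 ∪ S₀ q.2) e)}
  have hlaw (s : Set (Fin n → ℝ)) : μ.real (ε ⁻¹' s) ≤ γ.real s := by
    have h := Measure.le_map_apply hε.aemeasurable s
    rw [hε.map_eq] at h
    exact ENNReal.toReal_mono (measure_ne_top _ _) h
  -- `G` need not be measurable, so its complement is avoided in favour of subadditivity.
  have hcover : (Set.univ : Set Ω) ⊆ G ∪ (ε ⁻¹' A ∪ ⋃ q, ε ⁻¹' U q) := by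
    intro ω _
    by_contra hω
    simp only [Set.mem_union, Set.mem_iUnion, not_or, not_exists] at hω
    obtain ⟨hωG, hωA, hωU⟩ := hω
    refine hωG fun i j => ?_
    have hdist : edist (X *ᵥ β + ε ω) (X *ᵥ β) < pathRobustness B Λ X (X *ᵥ β) := by
      refine lt_of_lt_of_le (edist_lt_ofReal.2 ?_) hD
      rw [dist_eq_norm, add_sub_cancel_left]
      exact not_le.1 hωA
    obtain ⟨k, hk⟩ := (hS _).exists_eq_of_edist_lt (hS (X *ᵥ β)) hdist i
    obtain ⟨l, hl⟩ := (hS _).exists_eq_of_edist_lt (hS (X *ᵥ β)) hdist j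
    rw [(hβbar _ i j).mulVec_eq_proj, sqNorm_proj_add_sub, hk, hl]
    have hU : sqNorm (proj X (S₀ k ∪ S₀ l) (ε ω)) ≤ (σ : ℝ) ^ 2 * a * (S₀ k ∪ S₀ l).card :=
      not_lt.1 (hωU (k, l))
    gcongr
  have hA : μ.real (ε ⁻¹' A) ≤ n * (2 * Real.exp (-c ^ 2 / (2 * (σ : ℝ) ^ 2))) :=
    (hlaw A).trans (pi_gaussianReal_real_le_norm hσ hc)
  have hU : μ.real (⋃ q, ε ⁻¹' U q) ≤ (Λ.card : ℝ) ^ 2 * (√a * Real.exp (-(a - 1) / 2)) := by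
    calc μ.real (⋃ q, ε ⁻¹' U q) ≤ ∑ q, μ.real (ε ⁻¹' U q) := measureReal_iUnion_fintype_le _
      _ ≤ ∑ _q : Fin Λ.card × Fin Λ.card, √a * Real.exp (-(a - 1) / 2) :=
          Finset.sum_le_sum fun q _ =>
            (hlaw (U q)).trans (pi_gaussianReal_real_lt_sqNorm_proj hσ X _ ha)
      _ = _ := by simp [sq]
  have h1 : (1 : ℝ) ≤ μ.real G + (μ.real (ε ⁻¹' A) + μ.real (⋃ q, ε ⁻¹' U q)) := by
    calc (1 : ℝ) = μ.real Set.univ := by simp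
      _ ≤ μ.real (G ∪ (ε ⁻¹' A ∪ ⋃ q, ε ⁻¹' U q)) := measureReal_mono hcover
      _ ≤ _ := (measureReal_union_le _ _).trans (by gcongr; exact measureReal_union_le _ _)
  linarith

/-- The noise leaves the robustness radius with probability at most `2 n * n⁻³`. -/
lemma mul_two_mul_exp_le_inv {n : ℕ} {σ c t : ℝ} (hσ : 0 < σ) (hc : √6 * σ < c) (ht : 1 ≤ t)
    (hn : 2 * t ≤ n) :
    n * (2 * Real.exp (-(c * √(Real.log n)) ^ 2 / (2 * σ ^ 2))) ≤ 1 / t := by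
  have hn0 : (0 : ℝ) < n := by linarith
  have hlog : 0 ≤ Real.log n := Real.log_nonneg (by linarith)
  have hc2 : 6 * σ ^ 2 ≤ c ^ 2 := by
    have := pow_le_pow_left₀ (by positivity) hc.le 2
    rwa [mul_pow, Real.sq_sqrt (by norm_num)] at this
  have hexp : Real.exp (-(c * √(Real.log n)) ^ 2 / (2 * σ ^ 2)) ≤ ((n : ℝ) ^ 3)⁻¹ := by
    rw [← Real.exp_log (pow_pos hn0 3), ← Real.exp_neg, Real.log_pow, Real.exp_le_exp, mul_pow,
      Real.sq_sqrt hlog, div_le_iff₀ (by positivity)]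
    push_cast
    nlinarith
  calc n * (2 * Real.exp (-(c * √(Real.log n)) ^ 2 / (2 * σ ^ 2)))
      ≤ n * (2 * ((n : ℝ) ^ 3)⁻¹) := by gcongr
    _ = 2 / (n : ℝ) ^ 2 := by field_simp
    _ ≤ 1 / t := by
        rw [div_le_div_iff₀ (by positivity) (by linarith)]
        nlinarith

/-- The union bound over `r ^ 2` sets, with `√(1 + x) ≤ 2 x` for `x = t log r ≥ 1`. -/
lemma sq_mul_sqrt_mul_exp_le {r : ℕ} {t : ℝ} (hr : 2 ≤ r) (ht : 6 < t) :
    (r : ℝ) ^ 2 * (√(1 + t * Real.log r) * Real.exp (-(1 + t * Real.log r - 1) / 2)) ≤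
      2 * t * Real.log r / r := by
  have hr2 : (2 : ℝ) ≤ r := by exact_mod_cast hr
  have hr0 : (0 : ℝ) < r := by linarith
  have hlog : 1 / 2 < Real.log r := by
    have := Real.log_le_log two_pos hr2
    linarith [Real.log_two_gt_d9]
  have hx : 1 ≤ t * Real.log r := by nlinarith
  have hsqrt : √(1 + t * Real.log r) ≤ 2 * t * Real.log r := by
    rw [Real.sqrt_le_left (by nlinarith)]
    nlinarith
  have hexp : Real.exp (-(1 + t * Real.log r - 1) / 2) ≤ ((r : ℝ) ^ 3)⁻¹ := by
    rw [← Real.exp_log (pow_pos hr0 3), ← Real.exp_neg, Real.log_pow, Real.exp_le_exp]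
    push_cast
    nlinarith
  calc (r : ℝ) ^ 2 * (√(1 + t * Real.log r) * Real.exp (-(1 + t * Real.log r - 1) / 2))
      ≤ (r : ℝ) ^ 2 * (2 * t * Real.log r * ((r : ℝ) ^ 3)⁻¹) := by gcongr
    _ = 2 * t * Real.log r / r := by field_simp

end AVPrediction

theorem mainTheorem2
    {Ω : Type*} [MeasurableSpace Ω] (μ : Measure Ω) [IsProbabilityMeasure μ]
    (σ : ℝ≥0) (hσ : 0 < σ)
    -- for every sample size `n`: dimension, design, regression vector, noise
    (p : ℕ → ℕ) (X : ∀ n, Matrix (Fin n) (Fin (p n)) ℝ) (β : ∀ n, Fin (p n) → ℝ)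
    (ε : ∀ n, Ω → (Fin n → ℝ))
    (hε : ∀ n, HasLaw (ε n) (Measure.pi fun _ : Fin n => gaussianReal 0 (σ ^ 2)) μ)
    -- the data `Y = X β + ε`
    (Y : ∀ n, Ω → (Fin n → ℝ)) (hY : ∀ n ω, Y n ω = X n *ᵥ β n + ε n ω)
    -- the first-step family and its tuning parameters
    (B : ∀ n, AVPrediction.FirstStepFamily n (p n)) (Λ : ℕ → Finset ℝ)
    (hΛ : ∀ n, ∀ lam ∈ Λ n, 0 < lam)
    (hsym : ∀ n, AVPrediction.ScaleSymmetric (B n) (Λ n))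
    (hgrowth : AVPrediction.GrowthCondition σ B Λ X β)
    -- the ordered active sets `S^i` at the data
    (S : ∀ n, (Fin n → ℝ) → Fin (Λ n).card → Finset (Fin (p n)))
    (hS : ∀ n y, AVPrediction.IsOrderedPath (B n) (Λ n) (X n) y (S n y))
    -- the two-stage estimators, least-squares refits on `S^i ∪ S^j`
    (βbar : ∀ n, (Fin n → ℝ) → Fin (Λ n).card → Fin (Λ n).card → (Fin (p n) → ℝ))
    (hβbar : ∀ n y i j,
      AVPrediction.IsLeastSquares (X n) y (S n y i ∪ S n y j) (βbar n y i j))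
    (t : ℝ) (ht : 6 < t) :
    ∃ n₀ : ℕ, ∀ n ≥ n₀, 2 ≤ (Λ n).card →
      (1 - 1 / t - 2 * t * Real.log (Λ n).card / (Λ n).card ≤
        μ.real {ω | ∀ i j : Fin (Λ n).card,
          AVPrediction.sqNorm (X n *ᵥ βbar n (Y n ω) i j - X n *ᵥ β n) ≤
            (σ : ℝ) ^ 2 * (1 + t * Real.log (Λ n).card) *
                ((S n (Y n ω) i ∪ S n (Y n ω) j).card : ℝ) +
              AVPrediction.sqNorm (X n *ᵥ β n -
                AVPrediction.proj (X n) (S n (Y n ω) i ∪ S n (Y n ω) j) (X n *ᵥ β n))}) ∧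
      AVPrediction.PredictionBounds μ (X n) (β n)
        (fun ω => S n (Y n ω)) (fun ω => βbar n (Y n ω))
        (1 / t + 2 * t * Real.log (Λ n).card / (Λ n).card)
        ((σ : ℝ) ^ 2 * (1 + t * Real.log (Λ n).card)) := by
  obtain ⟨c, hc, n₁, hn₁⟩ := hgrowth
  have hσ' : (0 : ℝ) < σ := hσ
  refine ⟨max n₁ ⌈2 * t⌉₊, fun n hn hr => ?_⟩
  have hnt : 2 * t ≤ n := Nat.ceil_le.1 ((le_max_right _ _).trans hn)
  have hr2 : (2 : ℝ) ≤ (Λ n).card := by exact_mod_cast hr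
  have hlogn : 0 < Real.log n := Real.log_pos (by linarith)
  have hlogr : 0 < Real.log (Λ n).card := Real.log_pos (by linarith)
  have hx : 0 < t * Real.log (Λ n).card := by nlinarith
  have hc0 : 0 < c * √(Real.log n) :=
    mul_pos (lt_of_le_of_lt (by positivity) hc) (Real.sqrt_pos.2 hlogn)
  have hfinite := AVPrediction.le_measureReal_forall_prediction (a := 1 + t * Real.log (Λ n).card)
    hσ (hε n) hc0 (hn₁ n ((le_max_left _ _).trans hn)) (by linarith) (hS n) (hβbar n)
  have hnoise := AVPrediction.mul_two_mul_exp_le_inv hσ' hc (by linarith) hnt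
  have hunion := AVPrediction.sq_mul_sqrt_mul_exp_le hr ht
  simp only [← hY] at hfinite
  refine ⟨by linarith, by positivity, by positivity, ?_⟩
  linarith
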